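/- Let $[p]=\{1,\dots,p\}$ and let $G_1,\dots,G_M\subseteq[p]$ be (possibly overlapping) groups with $\bigcup_{i=1}^M G_i=[p]$. For $w\in\mathbb{R}^p$ let $\|w\|_0^{\mathcal G}$ be the smallest possible number of nonzero vectors among $a_1,\dots,a_M\in\mathbb{R}^p$, over all choices with $\sum_{i=1}^M a_i=w$ and $\operatorname{supp}(a_i)\subseteq G_i$ for every $i$; call $w$ $k$-group-sparse if $\|w\|_0^{\mathcal G}\le k$, and let $s=\max\{|\operatorname{supp}(w)| : \|w\|_0^{\mathcal G}\le k\}$. There is an absolute constant $c>0$ such that the following holds for every real $C\ge 1$, all $n,p,M,k$, all groups as above, and every positive semidefinite $\Sigma\in\mathbb{R}^{p\times p}$ with largest and smallest singular values $\sigma_{\max}$ and $\sigma_{\min}$. Let $X\in\mathbb{R}^{n\times p}$ be a random matrix whose rows are independent $N(0,\Sigma)$ vectors. If $$n\ \ge\ c\,C\,(k\log M+s)\qquad\text{and}\qquad n\ \ge\ c\,C\log C ,$$ then with probability at least $1-n^{-10}$, simultaneously for all $k$-group-sparse $w\in\mathbb{R}^p$, $$\Bigl(1-\frac{4}{\sqrt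 C}\Bigr)\sigma_{\min}\|w\|_2^2\ \le\ \frac1n\|Xw\|_2^2\ \le\ \Bigl(1+\frac{4}{\sqrt C}\Bigr)\sigma_{\max}\|w\|_2^2 .$$ -/

import Mathlib

open MeasureTheory ProbabilityTheory

namespace GroupSparse

noncomputable section

/-- The support of a vector of `ℝ^p`. -/
def supp {p : ℕ} (w : EuclideanSpace ℝ (Fin p)) : Finset (Fin p) :=
  {j | w j ≠ 0}

/-- `a` is a decomposition of `w` over the groups `G`: the vectors `a i` sum to `w`, and each `a i`
is supported in the group `G i`. -/
def IsGroupDecomposition {p M : ℕ} (G : Fin M → Finset (Fin p)) (w : EuclideanSpace ℝ (Fin p))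
    (a : Fin M → EuclideanSpace ℝ (Fin p)) : Prop :=
  ∑ i, a i = w ∧ ∀ i, supp (a i) ⊆ G i

open Classical in
/-- The group-`ℓ₀` pseudo-norm of `w`: the infimum, over all decompositions of `w` over the
groups `G`, of the number of nonzero components (`⊤` if there is no decomposition). -/
def groupL0 {p M : ℕ} (G : Fin M → Finset (Fin p)) (w : EuclideanSpace ℝ (Fin p)) : ℕ∞ :=
  ⨅ a ∈ {a : Fin M → EuclideanSpace ℝ (Fin p) | IsGroupDecomposition G w a},
    ∑ i, if 0 < ‖a i‖ then (1 : ℕ∞) else 0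

/-- The set of `k`-group-sparse vectors over the groups `G`. -/
def groupSparse {p M : ℕ} (G : Fin M → Finset (Fin p)) (k : ℕ) :
    Set (EuclideanSpace ℝ (Fin p)) :=
  {w | groupL0 G w ≤ k}

/-- The largest singular value of a square real matrix of size `p`. -/
def sigmaMax {p : ℕ} (S : Matrix (Fin p) (Fin p) ℝ) : ℝ :=
  S.toEuclideanLin.singularValues 0

/-- The smallest of the `p` singular values of a square real matrix of size `p`; Mathlib lists them
in decreasing order, starting from index `0`. -/
def sigmaMin {p : ℕ} (S : Matrix (Fin p) (Fin p) ℝ) : ℝ :=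
  S.toEuclideanLin.singularValues (p - 1)

/-- The `i`-th row of a matrix, as a vector of Euclidean space. -/
def row {n p : ℕ} (A : Matrix (Fin n) (Fin p) ℝ) (i : Fin n) : EuclideanSpace ℝ (Fin p) :=
  WithLp.toLp 2 (A i)

end

end GroupSparse

/-! Write each row of `X` as `Σ^{1/2} g` with `g` standard Gaussian. A sparse `w` is supported on a
union of `k` groups, so `Σ^{1/2} w` lies in one of at most `M ^ k` fixed subspaces of dimension at
most `s`. With `ε = 1/√C`, the empirical second moment of `g` is within `4ε‖v‖²` of `‖v‖²` for all
`v` in one such subspace, except with probability `25^s · 2 exp(-nε²/16)`: a chi-square tail bound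
at the points of a `1/4`-net, then a passage from net to subspace
(`measureReal_exists_mem_submodule_le`). The union bound over subspaces gives `n^{-10}`
(`union_bound_le_one_div_pow`), and `σ_min‖w‖² ≤ ‖Σ^{1/2} w‖² ≤ σ_max‖w‖²` finishes. -/

/-! ### Nets and quadratic forms. -/

/-- A finite-dimensional normed space has a `1/4`-net of the unit ball with at most `25 ^ d` points. -/
theorem exists_finset_quarter_net (E : Type*) [NormedAddCommGroup E] [NormedSpace ℝ E]
    [FiniteDimensional ℝ E] :
    ∃ N : Finset E, N.card ≤ 25 ^ Module.finrank ℝ E ∧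
      ∀ u : E, ‖u‖ ≤ 1 → ∃ x ∈ N, ‖u - x‖ ≤ 1 / 4 := by
  classical
  let A : Set ℕ := {m | ∃ s : Finset E, ((∀ c ∈ s, ‖c‖ ≤ 2) ∧
    ∀ c ∈ s, ∀ d ∈ s, c ≠ d → 1 ≤ ‖c - d‖) ∧ s.card = m}
  have hbdd : BddAbove A := by
    refine ⟨5 ^ Module.finrank ℝ E, ?_⟩
    rintro m ⟨s, hs, rfl⟩
    exact Besicovitch.card_le_of_separated s hs.1 hs.2
  -- A 1-separated subset of the ball of radius 2 with the most points is a 1-net of that ball.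
  obtain ⟨s, ⟨hs2, hsep⟩, hcard⟩ : sSup A ∈ A := Nat.sSup_mem ⟨0, ∅, by simp⟩ hbdd
  have hnet : ∀ u : E, ‖u‖ ≤ 2 → ∃ x ∈ s, ‖u - x‖ ≤ 1 := by
    intro u hu
    by_contra! h
    have hus : u ∉ s := fun hus => by simpa using (h u hus).trans_le' zero_le_one
    have hmem : (insert u s).card ∈ A := by
      refine ⟨insert u s, ⟨?_, ?_⟩, rfl⟩
      · simpa [hu] using hs2
      · intro c hc d hd hcd
        rw [Finset.mem_insert] at hc hd
        rcases hc with rfl | hc <;> rcases hd with rfl | hd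
        · exact absurd rfl hcd
        · exact (h d hd).le
        · rw [norm_sub_rev]; exact (h c hc).le
        · exact hsep c hc d hd hcd
    have := le_csSup hbdd hmem
    rw [Finset.card_insert_of_notMem hus] at this
    omega
  -- Two rounds of approximation: `x` is within 1 of `2u` and `y` within 1 of `2(2u - x)`, so `x/2 +
  -- y/4` is within `1/4` of `u`. Pairs account for `25 = 5²`.
  refine ⟨(s ×ˢ s).image fun q => (1 / 2 : ℝ) • q.1 + (1 / 4 : ℝ) • q.2, ?_, ?_⟩
  · calc _ ≤ s.card * s.card := Finset.card_image_le.trans (Finset.card_product _ _).le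
      _ ≤ 5 ^ Module.finrank ℝ E * 5 ^ Module.finrank ℝ E := by
        gcongr <;> exact Besicovitch.card_le_of_separated s hs2 hsep
      _ = 25 ^ Module.finrank ℝ E := by rw [← mul_pow]; norm_num
  · intro u hu
    have norm_smul_two : ∀ v : E, ‖v‖ ≤ 1 → ‖(2 : ℝ) • v‖ ≤ 2 := fun v hv => by
      rw [norm_smul, Real.norm_ofNat]; linarith
    obtain ⟨x, hx, hux⟩ := hnet _ (norm_smul_two u hu)
    obtain ⟨y, hy, hxy⟩ := hnet _ (norm_smul_two _ hux)
    refine ⟨_, Finset.mem_image.2 ⟨(x, y), Finset.mk_mem_product hx hy, rfl⟩, ?_⟩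
    have : u - ((1 / 2 : ℝ) • x + (1 / 4 : ℝ) • y)
        = (1 / 4 : ℝ) • ((2 : ℝ) • ((2 : ℝ) • u - x) - y) := by module
    rw [this, norm_smul]
    norm_num
    linarith

/-- A symmetric bilinear form that is small on a `1/4`-net of the unit ball is small everywhere. -/
theorem LinearMap.BilinForm.abs_apply_self_le_of_quarter_net {E : Type*} [NormedAddCommGroup E]
    [InnerProductSpace ℝ E] [FiniteDimensional ℝ E] (B : LinearMap.BilinForm ℝ E)
    (hB : ∀ x y, B x y = B y x) (N : Set E) (hN : ∀ u : E, ‖u‖ ≤ 1 → ∃ x ∈ N, ‖u - x‖ ≤ 1 / 4)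
    {ε : ℝ} (hε : 0 ≤ ε) (hBN : ∀ x ∈ N, |B x x| ≤ ε * ‖x‖ ^ 2) (v : E) :
    |B v v| ≤ 4 * ε * ‖v‖ ^ 2 := by
  have hcont : Continuous fun v : E => |B v v| := by
    have h : Continuous fun v : E => (LinearMap.toContinuousLinearMap (B v)) v := by
      have h1 : Continuous fun v : E => LinearMap.toContinuousLinearMap (B v) :=
        (LinearMap.toContinuousLinearMap.toLinearMap ∘ₗ B).continuous_of_finiteDimensional
      exact h1.clm_apply continuous_id
    exact h.abs
  obtain ⟨u, hu, hmax⟩ := (isCompact_closedBall (0 : E) 1).exists_isMaxOn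
    ⟨0, by simp⟩ hcont.continuousOn
  rw [mem_closedBall_zero_iff] at hu
  set K := |B u u| with hK
  have hscale : ∀ w : E, |B w w| ≤ K * ‖w‖ ^ 2 := by
    intro w
    rcases eq_or_ne w 0 with rfl | hw
    · simp
    have hw' : 0 < ‖w‖ := norm_pos_iff.2 hw
    have h := hmax (show ‖w‖⁻¹ • w ∈ Metric.closedBall (0 : E) 1 by
      rw [mem_closedBall_zero_iff, norm_smul, norm_inv, norm_norm, inv_mul_cancel₀ hw'.ne'])
    simp only [map_smul, LinearMap.smul_apply, smul_eq_mul, abs_mul, abs_inv, abs_norm,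
      Set.mem_ofPred_eq] at h
    calc |B w w| = (‖w‖⁻¹ * (‖w‖⁻¹ * |B w w|)) * ‖w‖ ^ 2 := by field_simp
      _ ≤ K * ‖w‖ ^ 2 := by gcongr
  have hK0 : 0 ≤ K := abs_nonneg _
  obtain ⟨x, hx, hux⟩ := hN u hu
  have hxn : ‖x‖ ≤ 5 / 4 := by
    have := norm_sub_norm_le x u
    rw [norm_sub_rev] at this
    linarith
  -- Polarization of `B (u - x) (u + x)`; the weights 3 and 1/3 make both vectors have norm at most
  -- 3/4. The parallelogram law then yields `K ≤ (9/16) K + (25/16) ε`, hence `K ≤ (25/7) ε`.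
  have hid : 4 * (B u u - B x x)
      = B ((3 : ℝ) • (u - x) + (1 / 3 : ℝ) • (u + x)) ((3 : ℝ) • (u - x) + (1 / 3 : ℝ) • (u + x))
        - B ((3 : ℝ) • (u - x) - (1 / 3 : ℝ) • (u + x))
          ((3 : ℝ) • (u - x) - (1 / 3 : ℝ) • (u + x)) := by
    simp only [map_add, map_sub, map_smul, LinearMap.add_apply, LinearMap.sub_apply,
      LinearMap.smul_apply, smul_eq_mul, hB x u]
    ring
  have ha : ‖(3 : ℝ) • (u - x)‖ ≤ 3 / 4 := by
    rw [norm_smul, Real.norm_ofNat]; linarith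
  have hb : ‖(1 / 3 : ℝ) • (u + x)‖ ≤ 3 / 4 := by
    have := norm_add_le u x
    rw [norm_smul, Real.norm_of_nonneg (by norm_num)]; linarith
  have hpar := parallelogram_law_with_norm ℝ ((3 : ℝ) • (u - x)) ((1 / 3 : ℝ) • (u + x))
  have h1 := hscale ((3 : ℝ) • (u - x) + (1 / 3 : ℝ) • (u + x))
  have h2 := hscale ((3 : ℝ) • (u - x) - (1 / 3 : ℝ) • (u + x))
  have h3 := abs_sub (B ((3 : ℝ) • (u - x) + (1 / 3 : ℝ) • (u + x))
    ((3 : ℝ) • (u - x) + (1 / 3 : ℝ) • (u + x))) (B ((3 : ℝ) • (u - x) - (1 / 3 : ℝ) • (u + x))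
    ((3 : ℝ) • (u - x) - (1 / 3 : ℝ) • (u + x)))
  rw [← hid, abs_mul, abs_of_pos (by norm_num : (0 : ℝ) < 4)] at h3
  have hsum : ‖(3 : ℝ) • (u - x) + (1 / 3 : ℝ) • (u + x)‖ ^ 2
      + ‖(3 : ℝ) • (u - x) - (1 / 3 : ℝ) • (u + x)‖ ^ 2 ≤ 9 / 4 := by
    nlinarith [norm_nonneg ((3 : ℝ) • (u - x)), norm_nonneg ((1 / 3 : ℝ) • (u + x))]
  have hx2 : ε * ‖x‖ ^ 2 ≤ ε * (5 / 4) ^ 2 := by gcongr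
  have h4 : K ≤ |B u u - B x x| + |B x x| := by
    simpa using abs_add_le (B u u - B x x) (B x x)
  have h5 := mul_le_mul_of_nonneg_left hsum hK0
  have hKε : K ≤ 4 * ε := by
    have := hBN x hx
    linarith
  exact (hscale v).trans (by gcongr)

/-! ### Chi-square concentration. -/

/-- The left side is `E exp(l(g² - 1))` for a standard Gaussian `g`. The bound is half the
first-order Taylor estimate of `log (1 - x)` at `x = 2l`. -/
theorem Real.exp_neg_div_sqrt_one_sub_two_mul_le {l : ℝ} (hl : |l| ≤ 1 / 4) :
    Real.exp (-l) / √(1 - 2 * l) ≤ Real.exp (4 * l ^ 2) := by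
  obtain ⟨hl1, hl2⟩ := abs_le.1 hl
  have h2 : |2 * l| ≤ 1 / 2 := by rw [abs_mul, abs_of_pos two_pos]; linarith
  have hpos : 0 < 1 - 2 * l := by linarith
  have h := Real.abs_log_sub_add_sum_range_le (h2.trans_lt (by norm_num)) 1
  have hb : |2 * l| ^ (1 + 1) / (1 - |2 * l|) ≤ 8 * l ^ 2 := by
    rw [div_le_iff₀ (by linarith), sq_abs]
    nlinarith [sq_nonneg l]
  have h' := (neg_le_of_abs_le (h.trans hb))
  simp only [Finset.sum_range_one, zero_add, pow_one, Nat.cast_zero, div_one] at h'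
  rw [← Real.exp_log (Real.sqrt_pos.2 hpos), ← Real.exp_sub, Real.exp_le_exp,
    Real.log_sqrt hpos.le]
  linarith

section ChiSquare

theorem gaussianPDFReal_zero_one_mul_exp (l x : ℝ) :
    gaussianPDFReal 0 1 x * Real.exp (l * (x ^ 2 - 1))
      = (√(2 * Real.pi))⁻¹ * Real.exp (-l) * Real.exp (-(1 / 2 - l) * x ^ 2) := by
  rw [gaussianPDFReal, mul_assoc, ← Real.exp_add, mul_assoc _ (Real.exp _), ← Real.exp_add]
  congr 2
  · simp
  · simp; ring

theorem integrable_exp_mul_sq_sub_one_gaussianReal {l : ℝ} (hl : l < 1 / 2) :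
    Integrable (fun x => Real.exp (l * (x ^ 2 - 1))) (gaussianReal 0 1) := by
  rw [gaussianReal_of_var_ne_zero _ one_ne_zero,
    integrable_withDensity_iff_integrable_smul' (measurable_gaussianPDF _ _)
      (ae_of_all _ fun _ => gaussianPDF_lt_top)]
  simp only [toReal_gaussianPDF, smul_eq_mul, gaussianPDFReal_zero_one_mul_exp]
  exact (integrable_exp_neg_mul_sq (by linarith)).const_mul _

theorem integral_exp_mul_sq_sub_one_gaussianReal_le {l : ℝ} (hl : |l| ≤ 1 / 4) :
    ∫ x, Real.exp (l * (x ^ 2 - 1)) ∂gaussianReal 0 1 ≤ Real.exp (4 * l ^ 2) := by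
  obtain ⟨hl1, hl2⟩ := abs_le.1 hl
  refine le_of_eq_of_le ?_ (Real.exp_neg_div_sqrt_one_sub_two_mul_le hl)
  rw [integral_gaussianReal_eq_integral_smul one_ne_zero]
  simp only [smul_eq_mul, gaussianPDFReal_zero_one_mul_exp]
  rw [integral_const_mul, integral_gaussian,
    show Real.pi / (1 / 2 - l) = 2 * Real.pi / (1 - 2 * l) by field_simp,
    Real.sqrt_div (by positivity)]
  have : √(2 * Real.pi) ≠ 0 := by positivity
  field_simp

variable {E : Type*} [NormedAddCommGroup E] [InnerProductSpace ℝ E] [FiniteDimensional ℝ E]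
  [MeasurableSpace E] [BorelSpace E]

theorem map_inner_stdGaussian {v : E} (hv : ‖v‖ = 1) :
    (stdGaussian E).map (fun g => inner ℝ v g) = gaussianReal 0 1 := by
  have h := IsGaussian.map_eq_gaussianReal (μ := stdGaussian E) (innerSL ℝ v)
  rw [integral_strongDual_stdGaussian, variance_dual_stdGaussian, innerSL_apply_norm, hv] at h
  simpa using h

/-- Chernoff bound for one tail of a chi-square variable; the sign of `l` selects the tail. -/
theorem measureReal_le_sum_inner_sq_sub_one_le {v : E} (hv : ‖v‖ = 1) (n : ℕ) (t l : ℝ)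
    (hl : |l| ≤ 1 / 4) :
    (Measure.pi fun _ : Fin n => stdGaussian E).real
      {g | t ≤ l * ∑ i, (inner ℝ v (g i) ^ 2 - 1)} ≤ Real.exp (-t + n * (4 * l ^ 2)) := by
  set μ := Measure.pi fun _ : Fin n => stdGaussian E
  have hmeas : Measurable fun x : E => inner ℝ v x := by fun_prop
  have hint1 : Integrable (fun x => Real.exp (l * (inner ℝ v x ^ 2 - 1))) (stdGaussian E) := by
    have h := integrable_exp_mul_sq_sub_one_gaussianReal ((le_abs_self l).trans_lt
      (hl.trans_lt (by norm_num : (1 / 4 : ℝ) < 1 / 2)))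
    rw [← map_inner_stdGaussian hv] at h
    exact h.comp_measurable hmeas
  have hprod : (fun g : Fin n → E => Real.exp (1 * (l * ∑ i, (inner ℝ v (g i) ^ 2 - 1))))
      = fun g => ∏ i, Real.exp (l * (inner ℝ v (g i) ^ 2 - 1)) := by
    ext g
    rw [one_mul, Finset.mul_sum, Real.exp_sum]
  have hint : Integrable (fun g : Fin n → E =>
      Real.exp (1 * (l * ∑ i, (inner ℝ v (g i) ^ 2 - 1)))) μ := by
    rw [hprod]
    exact Integrable.fintype_prod fun _ => hint1
  refine (measure_ge_le_exp_mul_mgf t zero_le_one hint).trans ?_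
  have hle : ∫ x, Real.exp (l * (inner ℝ v x ^ 2 - 1)) ∂stdGaussian E ≤ Real.exp (4 * l ^ 2) := by
    refine le_of_eq_of_le ?_ (integral_exp_mul_sq_sub_one_gaussianReal_le hl)
    rw [← map_inner_stdGaussian hv, integral_map hmeas.aemeasurable (by fun_prop)]
  rw [mgf, hprod, integral_fintype_prod_eq_pow (fun x : E => Real.exp (l * (inner ℝ v x ^ 2 - 1))),
    Fintype.card_fin, neg_one_mul, Real.exp_add, Real.exp_nat_mul]
  gcongr

theorem measureReal_abs_average_inner_sq_sub_le (v : E) {n : ℕ} (hn : 0 < n) {ε : ℝ} (hε : 0 ≤ ε)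
    (hε2 : ε ≤ 2) :
    (Measure.pi fun _ : Fin n => stdGaussian E).real
      {g | ε * ‖v‖ ^ 2 < |1 / n * ∑ i, inner ℝ v (g i) ^ 2 - ‖v‖ ^ 2|}
      ≤ 2 * Real.exp (-(n * ε ^ 2 / 16)) := by
  rcases eq_or_ne v 0 with rfl | hv
  · simp; positivity
  have hv' : 0 < ‖v‖ := norm_pos_iff.2 hv
  have hn' : (0 : ℝ) < n := by exact_mod_cast hn
  set u : E := ‖v‖⁻¹ • v
  have hu : ‖u‖ = 1 := by rw [norm_smul, norm_inv, norm_norm, inv_mul_cancel₀ hv'.ne']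
  have hvu : v = ‖v‖ • u := by simp [u, smul_smul, hv'.ne']
  -- `l = ±ε/8` minimizes the Chernoff exponent `n(4l² - ε|l|)`, with value `-nε²/16`; `ε ≤ 2` keeps
  -- `l` admissible.
  have habs : |ε / 8| ≤ 1 / 4 := by rw [abs_of_nonneg (by positivity)]; linarith
  have hsub : {g : Fin n → E | ε * ‖v‖ ^ 2 < |1 / n * ∑ i, inner ℝ v (g i) ^ 2 - ‖v‖ ^ 2|}
      ⊆ {g | ε ^ 2 / 8 * n ≤ (ε / 8) * ∑ i, (inner ℝ u (g i) ^ 2 - 1)}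
        ∪ {g | ε ^ 2 / 8 * n ≤ (-(ε / 8)) * ∑ i, (inner ℝ u (g i) ^ 2 - 1)} := by
    intro g hg
    have hrew : 1 / n * ∑ i, inner ℝ v (g i) ^ 2 - ‖v‖ ^ 2
        = (1 / n * ∑ i, (inner ℝ u (g i) ^ 2 - 1)) * ‖v‖ ^ 2 := by
      have : ∀ i, inner ℝ v (g i) ^ 2 = ‖v‖ ^ 2 * inner ℝ u (g i) ^ 2 := fun i => by
        conv_lhs => rw [hvu, real_inner_smul_left, mul_pow]
      simp only [this, ← Finset.mul_sum, Finset.sum_sub_distrib]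
      simp only [Finset.sum_const, Finset.card_univ, Fintype.card_fin, nsmul_eq_mul, mul_one]
      field_simp
    rw [Set.mem_ofPred_eq, hrew, abs_mul, abs_of_pos (by positivity : 0 < ‖v‖ ^ 2),
      mul_lt_mul_iff_left₀ (by positivity), abs_mul, abs_of_pos (by positivity : 0 < 1 / (n : ℝ)),
      one_div_mul_eq_div, lt_div_iff₀ hn', lt_abs] at hg
    rcases hg with hg | hg
    · left
      rw [Set.mem_ofPred_eq]
      nlinarith
    · right
      rw [Set.mem_ofPred_eq]
      nlinarith
  refine (measureReal_mono hsub).trans ((measureReal_union_le _ _).trans ?_)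
  rw [two_mul]
  refine add_le_add ((measureReal_le_sum_inner_sq_sub_one_le hu n _ _ habs).trans ?_)
    ((measureReal_le_sum_inner_sq_sub_one_le hu n _ _ (by rwa [abs_neg])).trans ?_) <;>
  · rw [Real.exp_le_exp]; apply le_of_eq; ring

/-- Concentration of the empirical second moment of standard Gaussian vectors, uniformly over a
subspace. -/
theorem measureReal_exists_mem_submodule_le (V : Submodule ℝ E) {n d : ℕ} (hn : 0 < n)
    (hd : Module.finrank ℝ V ≤ d) {ε : ℝ} (hε : 0 ≤ ε) (hε2 : ε ≤ 2) :
    (Measure.pi fun _ : Fin n => stdGaussian E).real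
      {g | ∃ v ∈ V, 4 * ε * ‖v‖ ^ 2 < |1 / n * ∑ i, inner ℝ v (g i) ^ 2 - ‖v‖ ^ 2|}
      ≤ 25 ^ d * (2 * Real.exp (-(n * ε ^ 2 / 16))) := by
  obtain ⟨N, hcard, hN⟩ := exists_finset_quarter_net V
  have hsub : {g : Fin n → E |
        ∃ v ∈ V, 4 * ε * ‖v‖ ^ 2 < |1 / n * ∑ i, inner ℝ v (g i) ^ 2 - ‖v‖ ^ 2|}
      ⊆ ⋃ x ∈ N, {g | ε * ‖(x : E)‖ ^ 2 <
        |1 / n * ∑ i, inner ℝ (x : E) (g i) ^ 2 - ‖(x : E)‖ ^ 2|} := by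
    rintro g ⟨v, hv, hlt⟩
    by_contra hg
    simp only [Set.mem_iUnion, Set.mem_ofPred_eq, not_exists, not_lt] at hg
    let L : Fin n → V →ₗ[ℝ] ℝ := fun i => (innerₗ E (g i)).comp V.subtype
    let B : LinearMap.BilinForm ℝ V :=
      (1 / n : ℝ) • ∑ i, (LinearMap.mul ℝ ℝ).compl₁₂ (L i) (L i) - innerₗ V
    have hB : ∀ x y : V, B x y
        = 1 / n * ∑ i, inner ℝ (g i) (x : E) * inner ℝ (g i) (y : E) - inner ℝ x y := by
      intro x y
      simp [B, L, LinearMap.sum_apply]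
    have hBself : ∀ x : V, B x x = 1 / n * ∑ i, inner ℝ (x : E) (g i) ^ 2 - ‖(x : E)‖ ^ 2 := by
      intro x
      rw [hB, real_inner_self_eq_norm_sq, Submodule.coe_norm]
      simp only [real_inner_comm, sq]
    have := B.abs_apply_self_le_of_quarter_net
      (fun x y => by rw [hB, hB, real_inner_comm]; simp only [mul_comm]) N hN hε
      (fun x hx => by rw [hBself]; exact hg x hx) ⟨v, hv⟩
    rw [hBself] at this
    exact absurd hlt (not_lt.2 this)
  calc _ ≤ _ := measureReal_mono hsub (measure_ne_top _ _)
    _ ≤ ∑ x ∈ N, (Measure.pi fun _ : Fin n => stdGaussian E).real {g | ε * ‖(x : E)‖ ^ 2 <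
        |1 / n * ∑ i, inner ℝ (x : E) (g i) ^ 2 - ‖(x : E)‖ ^ 2|} :=
      measureReal_biUnion_finset_le _ _
    _ ≤ ∑ _x ∈ N, 2 * Real.exp (-(n * ε ^ 2 / 16)) :=
      Finset.sum_le_sum fun x _ => measureReal_abs_average_inner_sq_sub_le (x : E) hn hε hε2
    _ = N.card * (2 * Real.exp (-(n * ε ^ 2 / 16))) := by rw [Finset.sum_const, nsmul_eq_mul]
    _ ≤ _ := by
      gcongr
      calc (N.card : ℝ) ≤ 25 ^ Module.finrank ℝ V := by exact_mod_cast hcard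
        _ ≤ 25 ^ d := pow_le_pow_right₀ (by norm_num) hd

end ChiSquare

/-! ### Group-sparse vectors and unions of groups. -/

namespace GroupSparse

section Support

variable {p M k : ℕ} {G : Fin M → Finset (Fin p)} {w : EuclideanSpace ℝ (Fin p)}

theorem exists_supp_subset_biUnion_of_mem_groupSparse (hw : w ∈ groupSparse G k) :
    ∃ J : Finset (Fin M), J.card ≤ k ∧ supp w ⊆ J.biUnion G := by
  classical
  -- A strict bound on the infimum produces a decomposition without proving that the infimum is
  -- attained.
  have hlt : groupL0 G w < (k : ℕ∞) + 1 :=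
    lt_of_le_of_lt hw (ENat.lt_add_one_iff (ENat.natCast_ne_top k) |>.2 le_rfl)
  simp only [groupL0, iInf_lt_iff] at hlt
  obtain ⟨a, ⟨hsum, hsupp⟩, ha⟩ := hlt
  refine ⟨Finset.univ.filter fun i => 0 < ‖a i‖, ?_, ?_⟩
  · have h := (ENat.lt_add_one_iff (ENat.natCast_ne_top k)).1 ha
    rw [Finset.sum_boole] at h
    exact_mod_cast h
  · intro j hj
    rw [supp, Finset.mem_filter_univ, ← hsum, WithLp.ofLp_sum, Finset.sum_apply] at hj
    obtain ⟨i, -, hi⟩ := Finset.exists_ne_zero_of_sum_ne_zero hj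
    rw [Finset.mem_biUnion]
    refine ⟨i, ?_, hsupp i (by simpa [supp] using hi)⟩
    rw [Finset.mem_filter_univ, norm_pos_iff]
    rintro h
    simp [h] at hi

/-- Groups may overlap, so each support coordinate is assigned to one group of `J` containing it;
`none` marks the zero coordinates. -/
theorem mem_groupSparse_of_supp_subset_biUnion {J : Finset (Fin M)} (hJ : J.card ≤ k)
    (hw : supp w ⊆ J.biUnion G) : w ∈ groupSparse G k := by
  classical
  have hex : ∀ j : Fin p, ∃ i : Option (Fin M), w j ≠ 0 → ∃ i' ∈ J, i = some i' ∧ j ∈ G i' := by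
    intro j
    by_cases hj : w j = 0
    · exact ⟨none, fun h => absurd hj h⟩
    · obtain ⟨i, hi, hji⟩ := Finset.mem_biUnion.1 (hw (by simpa [supp] using hj))
      exact ⟨some i, fun _ => ⟨i, hi, rfl, hji⟩⟩
  choose φ hφ using hex
  let a : Fin M → EuclideanSpace ℝ (Fin p) := fun i =>
    WithLp.toLp 2 fun j => if φ j = some i then w j else 0
  have hdec : IsGroupDecomposition G w a := by
    refine ⟨?_, fun i j hj => ?_⟩
    · ext j
      rw [WithLp.ofLp_sum, Finset.sum_apply]
      by_cases hj : w j = 0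
      · simp [a, hj]
      · obtain ⟨i, -, hi, -⟩ := hφ j hj
        simp [a, hi]
    · simp only [supp, a, Finset.mem_filter_univ, ne_eq, ite_eq_right_iff, Classical.not_imp] at hj
      obtain ⟨i', -, hi', hmem⟩ := hφ j hj.2
      rw [hi', Option.some_inj] at hj
      exact hj.1 ▸ hmem
  rw [groupSparse, Set.mem_ofPred_eq, groupL0]
  refine iInf₂_le_of_le a hdec ?_
  rw [Finset.sum_boole]
  have hsub : (Finset.univ.filter fun i => 0 < ‖a i‖) ⊆ J := by
    intro i hi
    rw [Finset.mem_filter_univ, norm_pos_iff] at hi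
    by_contra hiJ
    refine hi ?_
    ext j
    simp only [a, PiLp.zero_apply, ite_eq_right_iff]
    intro hj
    by_contra hwj
    obtain ⟨i', hi', hii', -⟩ := hφ j hwj
    rw [hj, Option.some_inj] at hii'
    exact hiJ (hii' ▸ hi')
  exact_mod_cast (Finset.card_le_card hsub).trans hJ

/-- The indicator vector of the union is itself `k`-group-sparse. This bounds the dimensions in the
union bound by `s`. -/
theorem card_biUnion_le_of_isGreatest {s : ℕ}
    (hs : IsGreatest {m : ℕ | ∃ w ∈ groupSparse G k, (supp w).card = m} s)
    {J : Finset (Fin M)} (hJ : J.card ≤ k) : (J.biUnion G).card ≤ s := by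
  classical
  have hsupp : supp (WithLp.toLp 2 fun j => if j ∈ J.biUnion G then (1 : ℝ) else 0)
      = J.biUnion G := by
    ext j; simp [supp]
  exact hs.2 ⟨_, mem_groupSparse_of_supp_subset_biUnion hJ hsupp.subset, by rw [hsupp]⟩

theorem supp_eq_empty_iff : supp w = ∅ ↔ w = 0 := by
  simp only [supp, Finset.filter_eq_empty_iff, Finset.mem_univ, true_imp_iff, not_not]
  exact ⟨fun h => by ext j; exact @h j, fun h j => by simp [h]⟩

/-- A nonzero `k`-group-sparse vector is supported on a union of `k` groups, indexed with
repetitions. -/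
theorem exists_supp_subset_biUnion_image (hw : w ∈ groupSparse G k) (hw0 : w ≠ 0) :
    ∃ f : Fin k → Fin M, supp w ⊆ (Finset.univ.image f).biUnion G := by
  obtain ⟨J, hJ, hsub⟩ := exists_supp_subset_biUnion_of_mem_groupSparse hw
  have hne : J.Nonempty := by
    rw [Finset.nonempty_iff_ne_empty]
    rintro rfl
    exact hw0 (supp_eq_empty_iff.1 (by simpa using hsub))
  obtain ⟨i₀, hi₀⟩ := hne
  let e := J.equivFin
  -- The enumeration of `J` is padded with `i₀`, so that exactly `M ^ k` index functions occur in
  -- the union bound.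
  refine ⟨fun m => if h : m < J.card then e.symm ⟨m, h⟩ else i₀, hsub.trans ?_⟩
  refine Finset.biUnion_subset_biUnion_of_subset_left _ fun i hi => ?_
  rw [Finset.mem_image]
  have hlt := (e ⟨i, hi⟩).2
  refine ⟨⟨e ⟨i, hi⟩, hlt.trans_le hJ⟩, Finset.mem_univ _, ?_⟩
  simp

end Support

/-! ### Singular values and the square root of the covariance. -/

section SingularValues

variable {p : ℕ} {S : Matrix (Fin p) (Fin p) ℝ}

open scoped MatrixOrder in
/-- The positive semidefinite square root of `S`, as an operator on Euclidean space. -/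
noncomputable def sqrtCLM (S : Matrix (Fin p) (Fin p) ℝ) :
    EuclideanSpace ℝ (Fin p) →L[ℝ] EuclideanSpace ℝ (Fin p) :=
  Matrix.toEuclideanCLM (𝕜 := ℝ) (CFC.sqrt S)

open scoped MatrixOrder in
theorem inner_sqrtCLM_left (S : Matrix (Fin p) (Fin p) ℝ) (x y : EuclideanSpace ℝ (Fin p)) :
    inner ℝ (sqrtCLM S x) y = inner ℝ x (sqrtCLM S y) := by
  have hS : IsSelfAdjoint (CFC.sqrt S) := (CFC.sqrt_nonneg S).isSelfAdjoint
  have h : IsSelfAdjoint (sqrtCLM S) := hS.map (Matrix.toEuclideanCLM (n := Fin p) (𝕜 := ℝ))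
  exact h.isSymmetric x y

open scoped MatrixOrder in
theorem norm_sqrtCLM_sq (hS : S.PosSemidef) (w : EuclideanSpace ℝ (Fin p)) :
    ‖sqrtCLM S w‖ ^ 2 = inner ℝ w (S.toEuclideanLin w) := by
  rw [← real_inner_self_eq_norm_sq, inner_sqrtCLM_left]
  have : sqrtCLM S (sqrtCLM S w) = Matrix.toEuclideanCLM (𝕜 := ℝ) S w := by
    rw [sqrtCLM, ← ContinuousLinearMap.comp_apply, ← ContinuousLinearMap.mul_def, ← map_mul,
      CFC.sqrt_mul_sqrt_self _ hS.nonneg]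
  rw [this]
  rfl

theorem _root_.LinearMap.IsSymmetric.inner_map_self_mem_Icc {E : Type*} [NormedAddCommGroup E]
    [InnerProductSpace ℝ E] [FiniteDimensional ℝ E] {T : E →ₗ[ℝ] E} (hT : T.IsSymmetric) {d : ℕ}
    (hd : Module.finrank ℝ E = d) {a b : ℝ} (h : ∀ i, hT.eigenvalues hd i ∈ Set.Icc a b) (w : E) :
    inner ℝ w (T w) ∈ Set.Icc (a * ‖w‖ ^ 2) (b * ‖w‖ ^ 2) := by
  set B := hT.eigenvectorBasis hd
  have hnorm : ‖w‖ ^ 2 = ∑ i, B.repr w i ^ 2 := by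
    rw [← B.repr.norm_map, EuclideanSpace.real_norm_sq_eq]
  have hinner : inner ℝ w (T w) = ∑ i, hT.eigenvalues hd i * B.repr w i ^ 2 := by
    rw [← B.repr.inner_map_map, PiLp.inner_apply]
    refine Finset.sum_congr rfl fun i _ => ?_
    rw [hT.eigenvectorBasis_apply_self_apply hd w i]
    simp only [RCLike.inner_apply, conj_trivial, RCLike.ofReal_real_eq_id, id_eq, B]
    ring
  rw [hnorm, hinner, Finset.mul_sum, Finset.mul_sum]
  exact ⟨Finset.sum_le_sum fun i _ => mul_le_mul_of_nonneg_right (h i).1 (sq_nonneg _),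
    Finset.sum_le_sum fun i _ => mul_le_mul_of_nonneg_right (h i).2 (sq_nonneg _)⟩

theorem sigmaMin_nonneg (S : Matrix (Fin p) (Fin p) ℝ) : 0 ≤ sigmaMin S :=
  LinearMap.singularValues_nonneg _ _

theorem sigmaMax_nonneg (S : Matrix (Fin p) (Fin p) ℝ) : 0 ≤ sigmaMax S :=
  LinearMap.singularValues_nonneg _ _

/-- The squared singular values are the eigenvalues of `T* T`, and `‖T e‖² = ⟨e, T* T e⟩`. -/
theorem sigmaMin_le_norm_and_norm_le_sigmaMax {e : EuclideanSpace ℝ (Fin p)} (he : ‖e‖ = 1) :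
    sigmaMin S ≤ ‖S.toEuclideanLin e‖ ∧ ‖S.toEuclideanLin e‖ ≤ sigmaMax S := by
  set T := S.toEuclideanLin
  have hd : Module.finrank ℝ (EuclideanSpace ℝ (Fin p)) = p := finrank_euclideanSpace_fin
  have h := T.isSymmetric_adjoint_comp_self.inner_map_self_mem_Icc hd
    (a := sigmaMin S ^ 2) (b := sigmaMax S ^ 2) (fun i => ?_) e
  · rw [LinearMap.comp_apply, LinearMap.adjoint_inner_right, real_inner_self_eq_norm_sq, he,
      one_pow, mul_one, mul_one] at h
    exact ⟨le_of_sq_le_sq h.1 (norm_nonneg _), le_of_sq_le_sq h.2 (sigmaMax_nonneg S)⟩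
  · rw [← T.sq_singularValues_fin hd]
    exact ⟨pow_le_pow_left₀ (sigmaMin_nonneg S) (T.singularValues_antitone (by omega)) 2,
      pow_le_pow_left₀ (T.singularValues_nonneg _) (T.singularValues_antitone (Nat.zero_le _)) 2⟩

/-- At a unit eigenvector `e` of `S`, `‖S e‖` is the eigenvalue, so every eigenvalue lies in
`[σ_min, σ_max]`; no matching of the two ordered lists is required. -/
theorem norm_sqrtCLM_sq_mem_Icc (hS : S.PosSemidef) (w : EuclideanSpace ℝ (Fin p)) :
    sigmaMin S * ‖w‖ ^ 2 ≤ ‖sqrtCLM S w‖ ^ 2 ∧ ‖sqrtCLM S w‖ ^ 2 ≤ sigmaMax S * ‖w‖ ^ 2 := by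
  have hpos := Matrix.isPositive_toEuclideanLin_iff.2 hS
  have hd : Module.finrank ℝ (EuclideanSpace ℝ (Fin p)) = p := finrank_euclideanSpace_fin
  rw [norm_sqrtCLM_sq hS]
  refine hpos.isSymmetric.inner_map_self_mem_Icc hd (fun i => ?_) w
  have hei := (hpos.isSymmetric.eigenvectorBasis hd).norm_eq_one i
  have h := sigmaMin_le_norm_and_norm_le_sigmaMax (S := S) hei
  rwa [hpos.isSymmetric.apply_eigenvectorBasis hd i, norm_smul, hei, mul_one,
    RCLike.ofReal_real_eq_id, id_eq,
    Real.norm_of_nonneg (hpos.nonneg_eigenvalues hd i)] at h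

end SingularValues

end GroupSparse

/-! ### Union bound and transfer to the rows of `X`. -/

namespace GroupSparse

theorem natCast_pow_le_exp_mul_log (M k : ℕ) : (M : ℝ) ^ k ≤ Real.exp (k * Real.log M) := by
  rcases Nat.eq_zero_or_pos M with rfl | hM
  · simpa using pow_le_one₀ (le_refl (0 : ℝ)) zero_le_one
  · rw [Real.exp_nat_mul, Real.exp_log (by exact_mod_cast hM)]

/-- With `u = n / C`, the terms `k log M`, `s` and `log C` are each at most `u/4096`, while the tail
exponent is `u/16 = 256 · u/4096`. Additive constants are absorbed by `s ≥ 1`. -/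
theorem union_bound_le_one_div_pow {C : ℝ} (hC : 1 ≤ C) {n M k s : ℕ} (hn : 0 < n) (hs : 1 ≤ s)
    (h1 : 4096 * (C * (k * Real.log M + s)) ≤ n) (h2 : 4096 * (C * Real.log C) ≤ n) :
    (M : ℝ) ^ k * (25 ^ s * (2 * Real.exp (-(n * (1 / √C) ^ 2 / 16)))) ≤ 1 / (n : ℝ) ^ 10 := by
  have hn' : (0 : ℝ) < n := by exact_mod_cast hn
  have hC' : 0 < C := by linarith
  have hs' : (1 : ℝ) ≤ s := by exact_mod_cast hs
  have hkM : 0 ≤ k * Real.log M := by positivity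
  set u : ℝ := n / C with hu
  have hnu : (n : ℝ) = u * C := by rw [hu]; field_simp
  have hu1 : 4096 * (k * Real.log M + s) ≤ u := by
    rw [hu, le_div_iff₀ hC']; linarith
  have hu2 : 4096 * Real.log C ≤ u := by
    rw [hu, le_div_iff₀ hC']; linarith
  have hupos : 0 < u := by positivity
  have hlogn : Real.log n = Real.log u + Real.log C := by
    rw [hnu, Real.log_mul hupos.ne' hC'.ne']
  have hlog2 := Real.log_two_lt_d9
  -- The tangent line of `log` at `4096 = 2 ^ 12`.
  have hlogu : Real.log u ≤ 12 * Real.log 2 + (u / 4096 - 1) := by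
    have h := Real.log_le_sub_one_of_pos (show 0 < u / 4096 by positivity)
    rw [Real.log_div hupos.ne' (by norm_num), show (4096 : ℝ) = 2 ^ 12 by norm_num,
      Real.log_pow] at h
    norm_num at h ⊢
    linarith
  have hlog25 : Real.log 25 ≤ 5 * Real.log 2 := by
    rw [← Nat.cast_ofNat (n := 5), ← Real.log_pow]
    exact Real.log_le_log (by norm_num) (by norm_num)
  have hlog25s : s * Real.log 25 ≤ s * 4 := by gcongr; linarith
  have hexp : (25 : ℝ) ^ s * (2 * Real.exp (-(n * (1 / √C) ^ 2 / 16)))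
      = Real.exp (s * Real.log 25 + Real.log 2 - u / 16) := by
    rw [sub_eq_add_neg, Real.exp_add, Real.exp_add, Real.exp_nat_mul, Real.exp_log (by norm_num),
      Real.exp_log two_pos, mul_assoc, div_pow, Real.sq_sqrt hC'.le, hu]
    congr 4
    field_simp
  calc (M : ℝ) ^ k * (25 ^ s * (2 * Real.exp (-(n * (1 / √C) ^ 2 / 16))))
      ≤ Real.exp (k * Real.log M) * Real.exp (s * Real.log 25 + Real.log 2 - u / 16) := by
        rw [hexp]
        gcongr
        exact natCast_pow_le_exp_mul_log M k
    _ ≤ Real.exp (-(10 * Real.log n)) := by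
        rw [← Real.exp_add, Real.exp_le_exp, hlogn]
        linarith
    _ = 1 / (n : ℝ) ^ 10 := by
        rw [Real.exp_neg, one_div, ← Nat.cast_ofNat (n := 10), Real.exp_nat_mul, Real.exp_log hn']

theorem norm_toEuclideanLin_sq {n p : ℕ} (A : Matrix (Fin n) (Fin p) ℝ)
    (w : EuclideanSpace ℝ (Fin p)) :
    ‖A.toEuclideanLin w‖ ^ 2 = ∑ i, inner ℝ w (row A i) ^ 2 := by
  rw [EuclideanSpace.real_norm_sq_eq]
  refine Finset.sum_congr rfl fun i _ => ?_
  simp [row, PiLp.inner_apply, Matrix.toLpLin_apply, Matrix.mulVec, dotProduct]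

theorem sqrtCLM_mem_span {p : ℕ} (S : Matrix (Fin p) (Fin p) ℝ) {w : EuclideanSpace ℝ (Fin p)}
    {U : Finset (Fin p)} (hw : supp w ⊆ U) :
    sqrtCLM S w ∈ Submodule.span ℝ
      ((U.image fun j => sqrtCLM S (EuclideanSpace.single j 1) : Finset _) : Set _) := by
  have hsum : w = ∑ j ∈ U, w j • EuclideanSpace.single j (1 : ℝ) := by
    ext i
    simp only [WithLp.ofLp_sum, Finset.sum_apply, PiLp.smul_apply, PiLp.single_apply, smul_eq_mul,
      mul_ite, mul_one, mul_zero, Finset.sum_ite_eq]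
    split_ifs with hi
    · rfl
    · by_contra h
      exact hi (hw (by simpa [supp] using h))
  rw [hsum, map_sum]
  refine Submodule.sum_mem _ fun j hj => ?_
  rw [map_smul]
  exact Submodule.smul_mem _ _ (Submodule.subset_span (Finset.mem_image_of_mem _ hj))

/-- Rows for which the empirical second moments of all vectors in `A` lie between `a‖w‖²` and
`b‖w‖²`. -/
def secondMomentBounds {n p : ℕ} (A : Set (EuclideanSpace ℝ (Fin p))) (a b : ℝ) :
    Set (Fin n → EuclideanSpace ℝ (Fin p)) :=
  {y | ∀ w ∈ A, a * ‖w‖ ^ 2 ≤ 1 / (n : ℝ) * ∑ i, inner ℝ w (y i) ^ 2 ∧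
    1 / (n : ℝ) * ∑ i, inner ℝ w (y i) ^ 2 ≤ b * ‖w‖ ^ 2}

/-- Closedness supplies measurability of an event that is an intersection over possibly uncountably
many `w`. -/
theorem isClosed_secondMomentBounds {n p : ℕ} (A : Set (EuclideanSpace ℝ (Fin p))) (a b : ℝ) :
    IsClosed (secondMomentBounds (n := n) A a b) := by
  simp only [secondMomentBounds, Set.ofPred_forall, Set.ofPred_and]
  refine isClosed_biInter fun w _ => ?_
  exact (isClosed_le (by fun_prop) (by fun_prop)).inter (isClosed_le (by fun_prop) (by fun_prop))

theorem measureReal_rows_mem_eq {Ω : Type*} [MeasurableSpace Ω] {P : Measure Ω}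
    [IsProbabilityMeasure P] {n p : ℕ} {S : Matrix (Fin p) (Fin p) ℝ}
    {Y : Fin n → Ω → EuclideanSpace ℝ (Fin p)}
    (hY : ∀ i, HasLaw (Y i) (multivariateGaussian 0 S) P) (hind : iIndepFun Y P)
    {A : Set (Fin n → EuclideanSpace ℝ (Fin p))} (hA : MeasurableSet A) :
    P.real {ω | (fun i => Y i ω) ∈ A}
      = (Measure.pi fun _ : Fin n => stdGaussian (EuclideanSpace ℝ (Fin p))).real
        {g | (fun i => sqrtCLM S (g i)) ∈ A} := by
  have hm : ∀ i, AEMeasurable (Y i) P := fun i => (hY i).aemeasurable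
  have hmap := (iIndepFun_iff_map_fun_eq_pi_map hm).1 hind
  have hlaw : ∀ i, P.map (Y i) = (stdGaussian _).map (sqrtCLM S) := fun i => by
    rw [(hY i).map_eq, multivariateGaussian]
    simp [sqrtCLM]
  have hmeas : Measurable (sqrtCLM S) := (sqrtCLM S).continuous.measurable
  have : ∀ _ : Fin n, SigmaFinite ((stdGaussian _).map (sqrtCLM S)) := fun _ =>
    haveI := Measure.isProbabilityMeasure_map (μ := stdGaussian (EuclideanSpace ℝ (Fin p)))
      hmeas.aemeasurable
    inferInstance
  simp only [hlaw] at hmap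
  rw [← Measure.pi_map_pi fun _ => hmeas.aemeasurable] at hmap
  have h1 := map_measureReal_apply_of_aemeasurable (μ := P) (aemeasurable_pi_lambda _ hm) hA
  have h2 := map_measureReal_apply (μ := Measure.pi fun _ : Fin n =>
    stdGaussian (EuclideanSpace ℝ (Fin p)))
    (measurable_pi_lambda _ fun i => hmeas.comp (measurable_pi_apply i)) hA
  rw [hmap] at h1
  exact h1.symm.trans h2

theorem one_sub_le_measureReal_secondMomentBounds {C : ℝ} (hC : 1 ≤ C) {n p M k s : ℕ}
    (G : Fin M → Finset (Fin p))
    (hs : IsGreatest {m : ℕ | ∃ w ∈ groupSparse G k, (supp w).card = m} s)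
    (hs1 : 1 ≤ s) (hn : 0 < n)
    (h1 : 4096 * (C * (k * Real.log M + s)) ≤ n) (h2 : 4096 * (C * Real.log C) ≤ n)
    {S : Matrix (Fin p) (Fin p) ℝ} (hS : S.PosSemidef) :
    1 - 1 / (n : ℝ) ^ 10 ≤ (Measure.pi fun _ : Fin n => stdGaussian (EuclideanSpace ℝ (Fin p))).real
      {g | (fun i => sqrtCLM S (g i)) ∈ secondMomentBounds (groupSparse G k)
        ((1 - 4 / √C) * sigmaMin S) ((1 + 4 / √C) * sigmaMax S)} := by
  classical
  set μ := Measure.pi fun _ : Fin n => stdGaussian (EuclideanSpace ℝ (Fin p))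
  have hsqrt : 1 ≤ √C := Real.one_le_sqrt.2 hC
  let ε : ℝ := 1 / √C
  have hε : 0 ≤ ε := by positivity
  have hε1 : ε ≤ 1 := by rw [div_le_one (by positivity)]; exact hsqrt
  have h4ε : 4 / √C = 4 * ε := by simp [ε, div_eq_mul_inv]
  set good := {g : Fin n → EuclideanSpace ℝ (Fin p) | (fun i => sqrtCLM S (g i)) ∈
    secondMomentBounds (groupSparse G k) ((1 - 4 / √C) * sigmaMin S) ((1 + 4 / √C) * sigmaMax S)}
  let V : (Fin k → Fin M) → Submodule ℝ (EuclideanSpace ℝ (Fin p)) := fun f =>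
    Submodule.span ℝ ((((Finset.univ.image f).biUnion G).image fun j =>
      sqrtCLM S (EuclideanSpace.single j 1) : Finset _) : Set _)
  let bad : (Fin k → Fin M) → Set (Fin n → EuclideanSpace ℝ (Fin p)) := fun f =>
    {g | ∃ v ∈ V f, 4 * ε * ‖v‖ ^ 2 < |1 / n * ∑ i, inner ℝ v (g i) ^ 2 - ‖v‖ ^ 2|}
  have hbad : ∀ f, μ.real (bad f) ≤ 25 ^ s * (2 * Real.exp (-(n * ε ^ 2 / 16))) := by
    intro f
    refine measureReal_exists_mem_submodule_le (V f) hn ?_ hε (by linarith)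
    refine (finrank_span_finset_le_card _).trans (Finset.card_image_le.trans ?_)
    refine card_biUnion_le_of_isGreatest hs (Finset.card_image_le.trans ?_)
    simp
  -- Covering the whole space leaves only subadditivity to use, so the bad events need not be shown
  -- measurable.
  have hsub : Set.univ ⊆ good ∪ ⋃ f, bad f := by
    intro g _
    by_contra hg
    simp only [Set.mem_union, Set.mem_iUnion, not_or, not_exists] at hg
    obtain ⟨hg1, hg2⟩ := hg
    refine hg1 fun w hw => ?_
    rcases eq_or_ne w 0 with rfl | hw0
    · simp
    obtain ⟨f, hf⟩ := exists_supp_subset_biUnion_image hw hw0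
    have hv : |1 / n * ∑ i, inner ℝ (sqrtCLM S w) (g i) ^ 2 - ‖sqrtCLM S w‖ ^ 2|
        ≤ 4 * ε * ‖sqrtCLM S w‖ ^ 2 := by
      by_contra! hlt
      exact hg2 f ⟨_, sqrtCLM_mem_span S hf, hlt⟩
    obtain ⟨hlo, hhi⟩ := abs_le.1 hv
    obtain ⟨hmin, hmax⟩ := norm_sqrtCLM_sq_mem_Icc hS w
    simp only [← inner_sqrtCLM_left S w, h4ε]
    have hnn : 0 ≤ 1 / (n : ℝ) * ∑ i, inner ℝ (sqrtCLM S w) (g i) ^ 2 := by positivity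
    have hσ : 0 ≤ sigmaMin S * ‖w‖ ^ 2 := mul_nonneg (sigmaMin_nonneg S) (sq_nonneg _)
    constructor
    · rw [mul_assoc]
      -- For `C ≤ 16` the lower factor is nonpositive and the lower bound is trivial.
      rcases le_total (1 - 4 * ε) 0 with hneg | hpos
      · exact (mul_nonpos_of_nonpos_of_nonneg hneg hσ).trans hnn
      · exact (mul_le_mul_of_nonneg_left hmin hpos).trans (by linarith)
    · rw [mul_assoc]
      exact le_trans (by linarith) (mul_le_mul_of_nonneg_left hmax (by positivity : 0 ≤ 1 + 4 * ε))
  have hunion : μ.real (⋃ f, bad f) ≤ 1 / (n : ℝ) ^ 10 := by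
    calc μ.real (⋃ f, bad f) ≤ ∑ f, μ.real (bad f) := measureReal_iUnion_fintype_le _
      _ ≤ ∑ _f : Fin k → Fin M, 25 ^ s * (2 * Real.exp (-(n * ε ^ 2 / 16))) :=
        Finset.sum_le_sum fun f _ => hbad f
      _ = (M : ℝ) ^ k * (25 ^ s * (2 * Real.exp (-(n * ε ^ 2 / 16)))) := by simp
      _ ≤ 1 / (n : ℝ) ^ 10 := union_bound_le_one_div_pow hC hn hs1 h1 h2
  have htot : 1 ≤ μ.real good + μ.real (⋃ f, bad f) := by
    calc (1 : ℝ) = μ.real Set.univ := probReal_univ.symm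
      _ ≤ μ.real (good ∪ ⋃ f, bad f) := measureReal_mono hsub
      _ ≤ _ := measureReal_union_le _ _
  linarith

end GroupSparse

theorem lemma2 :
    ∃ c : ℝ, 0 < c ∧
      ∀ (C : ℝ), 1 ≤ C →
      ∀ (n p M k s : ℕ) (G : Fin M → Finset (Fin p)),
      (∀ j : Fin p, ∃ i : Fin M, j ∈ G i) →
      IsGreatest {m : ℕ | ∃ w ∈ GroupSparse.groupSparse G k, (GroupSparse.supp w).card = m} s →
      c * (C * (k * Real.log M + s)) ≤ n →
      c * (C * Real.log C) ≤ n →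
      ∀ (S : Matrix (Fin p) (Fin p) ℝ), S.PosSemidef →
      ∀ {Ω : Type*} [MeasurableSpace Ω] (P : Measure Ω) [IsProbabilityMeasure P]
        (X : Ω → Matrix (Fin n) (Fin p) ℝ),
      (∀ i : Fin n, HasLaw (fun ω => GroupSparse.row (X ω) i) (multivariateGaussian 0 S) P) →
      iIndepFun (fun (i : Fin n) (ω : Ω) => GroupSparse.row (X ω) i) P →
      1 - 1 / (n : ℝ) ^ 10 ≤
        P.real {ω | ∀ w ∈ GroupSparse.groupSparse G k,
          (1 - 4 / √C) * GroupSparse.sigmaMin S * ‖w‖ ^ 2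
              ≤ 1 / (n : ℝ) * ‖(X ω).toEuclideanLin w‖ ^ 2 ∧
          1 / (n : ℝ) * ‖(X ω).toEuclideanLin w‖ ^ 2
              ≤ (1 + 4 / √C) * GroupSparse.sigmaMax S * ‖w‖ ^ 2} := by
  refine ⟨4096, by norm_num, fun C hC n p M k s G _ hs h1 h2 S hS Ω _ P _ X hX hind => ?_⟩
  -- If `s = 0`, only `w = 0` is sparse and the event is certain, even for `n = 0`; otherwise the
  -- sample-size hypothesis forces `n > 0`.
  rcases Nat.eq_zero_or_pos s with rfl | hs1
  · have hzero : ∀ w ∈ GroupSparse.groupSparse G k, w = 0 := fun w hw => by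
      have h := hs.2 ⟨w, hw, rfl⟩
      rwa [Nat.le_zero, Finset.card_eq_zero, GroupSparse.supp_eq_empty_iff] at h
    have huniv : 1 - 1 / (n : ℝ) ^ 10 ≤ P.real Set.univ := by
      rw [probReal_univ]
      exact sub_le_self _ (by positivity)
    convert huniv
    refine Set.eq_univ_of_forall fun ω w hw => ?_
    simp [hzero w hw]
  have hs' : (1 : ℝ) ≤ s := by exact_mod_cast hs1
  have hn : 0 < n := by
    have hkM : 0 ≤ k * Real.log M := by positivity
    have : 0 < 4096 * (C * (k * Real.log M + s)) := by positivity
    exact_mod_cast this.trans_le h1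
  have h := GroupSparse.one_sub_le_measureReal_secondMomentBounds hC G hs hs1 hn h1 h2 hS
  rw [← GroupSparse.measureReal_rows_mem_eq hX hind
    (GroupSparse.isClosed_secondMomentBounds _ _ _).measurableSet] at h
  simp only [GroupSparse.norm_toEuclideanLin_sq]
  exact h
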